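/- Let $0<s<1$. Let $R_s^+=[0,s]\times[0,1]$ and $R_s^-=[-s,0]\times[s,1+s]$, two rectangles of width $s$ and height $1$ whose union is an octagon in the plane; they meet in the segment $E=\{0\}\times[s,1]$ of length $1-s$. Let $X_s$ be the quotient of this octagon obtained by identifying its edges as follows, by translations and direct homotheties (maps $z\mapsto az+b$ with $a>0$): $(x,0)\sim(x,1)$ for $0\le x\le s$; $(x,s)\sim(x,1+s)$ for $-s\le x\le 0$; $(s,y)\sim(0,sy)$ for $0\le y\le 1$; and $(-s,y)\sim(0,1+s(y-s))$ for $s\le y\le 1+s$. This is a closed surface of genus $2$; all vertices are identified to a single singular point, whose complement has an atlas of charts, read off from the octagon, with direct homotheties as transition maps. A linear trajectory on $X_s$ is a curve $\tau:I\to X_s$, where $I\subseteq\mathbb{R}$ is an interval of positive length, which is continuous on $I$, maps the interior of $I$ to the nonsingular part of $X_s$, and is there given in local coordinates by affine functions of the parameter with nonzero derivative, of the same slope in $\mathbb{R}\cup\{\infty\}$ at all times. (The speed need not agree from chart to chart, and the interval $I$ may or may not be maximal.) A subsurface of $X_s$ is a subset $Y$ containing a nonsingular point such that at every nonsingular point of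 $Y$ there is a topological chart of $X_s$ that maps $Y$ locally to an open subset of the plane or, with the point on the boundary line, of a closed half-plane. Then for every linear trajectory $\tau:I\to X_s$, the image $\tau(I)$ is not dense in $X_s$, and for every subsurface $Y$ of $X_s$ the image is not dense in $Y$, that is, $Y\not\subseteq\overline{\tau(I)}$. -/

import Mathlib

open Set Filter Topology

/-- The eight-sided polygon formed by the rectangles `R⁺ = [0,s] × [0,1]` and
`R⁻ = [-s,0] × [s,1+s]`. They meet exactly in the segment `E = {0} × [s,1]` of length `1 - s`,
which is the top of the left-hand side of `R⁺` and the bottom of the right-hand side of `R⁻`. -/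
def octagon (s : ℝ) : Set (ℝ × ℝ) :=
  Icc 0 s ×ˢ Icc 0 1 ∪ Icc (-s) 0 ×ˢ Icc s (1 + s)

/-- The vertices of the polygon. -/
def octagonVertices (s : ℝ) : Set (ℝ × ℝ) :=
  {(0, 0), (s, 0), (s, 1), (0, 1), (0, 1 + s), (-s, 1 + s), (-s, s), (0, s)}

/-- The identifications of the edges of the polygon. Horizontal edges (`B` of `R⁺` and `D` of
`R⁻`) are identified by translations. The right side of `R⁺` (length `1`) is identified with the
bottom part of length `s` of its left side, and the left side of `R⁻` (length `1`) with the top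
part of length `s` of its right side, by direct homotheties with factor `s`. -/
inductive EdgeGlue (s : ℝ) : ℝ × ℝ → ℝ × ℝ → Prop
  | edgeA (y : ℝ) (hy : y ∈ Icc (0 : ℝ) 1) : EdgeGlue s (s, y) (0, s * y)
  | edgeB (x : ℝ) (hx : x ∈ Icc (0 : ℝ) s) : EdgeGlue s (x, 0) (x, 1)
  | edgeC (y : ℝ) (hy : y ∈ Icc s (1 + s)) : EdgeGlue s (-s, y) (0, 1 + s * (y - s))
  | edgeD (x : ℝ) (hx : x ∈ Icc (-s) (0 : ℝ)) : EdgeGlue s (x, s) (x, 1 + s)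

/-- The surface `X_s`: the quotient of the polygon by the equivalence relation generated by the
edge identifications. -/
def HomSurface (s : ℝ) : Type :=
  Quot (fun p q : octagon s => EdgeGlue s p q)

/-- `X_s` carries the quotient topology. -/
instance (s : ℝ) : TopologicalSpace (HomSurface s) :=
  inferInstanceAs (TopologicalSpace (Quot (fun p q : octagon s => EdgeGlue s p q)))

/-- The projection of the polygon to `X_s`. -/
def HomSurface.proj (s : ℝ) (p : octagon s) : HomSurface s :=
  Quot.mk _ p

/-- The singular set `Z` of `X_s`: the image of the vertices (a single point). -/
def singularSet (s : ℝ) : Set (HomSurface s) :=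
  {x | ∃ p : octagon s, (p : ℝ × ℝ) ∈ octagonVertices s ∧ x = HomSurface.proj s p}

/-- Names of the charts of `X_s` away from the singular set: one for the interior of the polygon
(which contains the interior of the segment `E`) and one around the interior of each edge. -/
inductive ChartName
  | inner | A | B | C | D

/-- The open subset of the plane that is the image of a chart. -/
def chartDomain (s : ℝ) : ChartName → Set (ℝ × ℝ)
  | .inner => interior (octagon s)
  | .A => Ioo (s / 2) (s + 1 / 2) ×ˢ Ioo 0 1
  | .B => Ioo 0 s ×ˢ Ioo (1 / 2) (3 / 2)
  | .C => Ioo (-s - 1 / 2) (-s / 2) ×ˢ Ioo s (1 + s)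
  | .D => Ioo (-s) 0 ×ˢ Ioo (s + 1 / 2) (s + 3 / 2)

open Classical in
/-- The inverse of a chart, lifted to the polygon: the identity on the near side of the edge, and
the direct homothety that identifies this edge with its partner on the far side. -/
noncomputable def chartFold (s : ℝ) : ChartName → ℝ × ℝ → ℝ × ℝ
  | .inner, p => p
  | .A, p => if p.1 ≤ s then p else (s * (p.1 - s), s * p.2)
  | .B, p => if p.2 ≤ 1 then p else (p.1, p.2 - 1)
  | .C, p => if -s ≤ p.1 then p else (s * (p.1 + s), 1 + s * (p.2 - s))
  | .D, p => if p.2 ≤ 1 + s then p else (p.1, p.2 - 1)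

/-- `HasCoord s k q x`: the point `x` of `X_s` has coordinate `q` in the chart `k`. -/
def HasCoord (s : ℝ) (k : ChartName) (q : ℝ × ℝ) (x : HomSurface s) : Prop :=
  q ∈ chartDomain s k ∧ ∃ p : octagon s, (p : ℝ × ℝ) = chartFold s k q ∧ x = HomSurface.proj s p

/-- `τ`, restricted to `I`, is a linear trajectory on `X_s`: `I` is an interval of positive
length, `τ` is continuous on `I`, maps the interior of `I` to the complement of the singular set,
and in local coordinates it is on the interior of `I` an affine map `u ↦ q + (u - t) c v` with
`c ≠ 0`, where the vector `v ≠ 0`, which spans the direction of the trajectory, is the same at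
all times, while the speed may change with the chart. The vertical direction is allowed, and the
interval `I` need not be maximal. -/
structure IsLinearTrajectory (s : ℝ) (I : Set ℝ) (τ : ℝ → HomSurface s) : Prop where
  interval : I.OrdConnected
  nondegenerate : (interior I).Nonempty
  continuousOn : ContinuousOn τ I
  avoids_singular : ∀ t ∈ interior I, τ t ∉ singularSet s
  constant_slope : ∃ v : ℝ × ℝ, v ≠ 0 ∧ ∀ t ∈ interior I,
    ∃ (k : ChartName) (q : ℝ × ℝ) (c : ℝ), c ≠ 0 ∧
      ∀ᶠ u in 𝓝 t, HasCoord s k (q + ((u - t) * c) • v) (τ u)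

/-- `Y` is a subsurface of the surface `X` with singular set `Z`: it has a nonsingular point, and
each nonsingular point of `Y` is either an interior point of `Y` around which `X` has a
topological chart, or a boundary point around which some topological chart of `X` maps `Y` to a
half-plane. Nothing is required at singular points, so that `Y` may touch itself there. -/
def IsSubsurface {X : Type*} [TopologicalSpace X] (Z Y : Set X) : Prop :=
  (Y \ Z).Nonempty ∧ ∀ p ∈ Y \ Z, ∃ e : OpenPartialHomeomorph X (ℝ × ℝ), p ∈ e.source ∧
    (e.source ⊆ Y ∨ ((e p).1 = 0 ∧ ∀ x ∈ e.source, x ∈ Y ↔ 0 ≤ (e x).1))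

/-! A trajectory that moves to the right and has entered `R⁺` is trapped there: the horizontal edges
of `R⁺` are glued to each other, and its right-hand side is glued to part of its left-hand side with
contraction factor `s`. For slope `m`, follow the height `h` modulo `1` at which the current line
meets the left-hand side. It is constant between two passages through the edge `A`, and such a
passage replaces it by `s * (h + m * s)`, where `0 ≤ h + m * s ≤ 1`.

Hence the set `H` of all heights of the trajectory lies, up to one class modulo `1`, in its own
image under maps of factor `s` (`LocallyAffine.crossingSet_subset`). The closure of `H` inherits
this, so its measure in one period is at most `s < 1` times itself. It is therefore null and has
empty interior (`interior_closure_eq_empty_of_subset_advance`), and the trajectory misses a nonempty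
open part of every nonempty open subset of the interior of `R⁺`.

The remaining cases reduce to this one or are simpler. Reversing time turns motion to the left into
motion to the right. Vertical trajectories keep their horizontal coordinate. The rotation by `π`
about the centre exchanges `R⁺` and `R⁻`. So the image of every linear trajectory is nowhere dense,
which suffices because every subsurface has nonempty interior. -/

/-! ### Functions on the surface -/

/-- The lift to `ℝ` of a point of `ℝ / ℤ`. -/
def intTranslates (a : ℝ) : Set ℝ := {r | ∃ n : ℤ, r = a + n}

/-- For a point of `R⁺`, the height modulo `1` at which the line of slope `m` through it meets the
left-hand side of `R⁺`; points of the edge `A` are seen on the right-hand side of `R⁺`. The empty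
set for the other points of the polygon. -/
def crossing (s m : ℝ) (p : ℝ × ℝ) : Set ℝ :=
  {r | (0 < p.1 ∧ (p.1 = s → 0 < p.2 ∧ p.2 < 1) ∧ ∃ n : ℤ, r = p.2 - m * p.1 + n) ∨
    (p.1 = 0 ∧ 0 < p.2 ∧ p.2 < s ∧ ∃ n : ℤ, r = p.2 / s - m * s + n)}

open Classical in
/-- The horizontal coordinate, with a choice at the vertical edges that is compatible with the
identifications. -/
noncomputable def horizontal (s : ℝ) (p : ℝ × ℝ) : ℝ :=
  if p.1 = -s then 0
  else if p.1 = 0 ∧ 0 < p.2 ∧ p.2 < s then s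
  else if p.1 = s ∧ ¬ (0 < p.2 ∧ p.2 < 1) then 0
  else p.1

/-- On `A` the division by `s` undoes the homothety; on `B` the shift by `1` is absorbed by the
integer. Along `C` and `D`, and at all vertices, both sides are empty. -/
theorem crossing_eq_of_edgeGlue {s : ℝ} (hs0 : 0 < s) (hs1 : s < 1) (m : ℝ) {p q : ℝ × ℝ}
    (h : EdgeGlue s p q) : crossing s m p = crossing s m q := by
  ext r
  simp only [crossing, mem_ofPred_eq]
  cases h with
  | edgeA y hy =>
    have e : s * y / s = y := by field_simp
    constructor
    · rintro (⟨-, h, n, hn⟩ | ⟨h, -⟩)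
      · obtain ⟨h1, h2⟩ := h rfl
        refine Or.inr ⟨rfl, by positivity, by simpa using mul_lt_mul_of_pos_left h2 hs0, n, ?_⟩
        simp only [e]
        rw [hn]
      · exact absurd h hs0.ne'
    · rintro (⟨h, -⟩ | ⟨-, h1, h2, n, hn⟩)
      · exact absurd h (lt_irrefl _)
      · refine Or.inl ⟨hs0, fun _ => ⟨pos_of_mul_pos_right h1 hs0.le, ?_⟩, n, ?_⟩
        · by_contra hc
          simp only at h2 hc
          nlinarith
        · simp only [e] at hn ⊢
          rw [hn]
  | edgeB x hx =>
    simp only at *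
    constructor
    · rintro (⟨h, h', n, hn⟩ | ⟨-, h, -⟩)
      · refine Or.inl ⟨h, fun hxs => absurd (h' hxs).1 (lt_irrefl _), n - 1, ?_⟩
        push_cast
        rw [hn]
        ring
      · exact absurd h (lt_irrefl _)
    · rintro (⟨h, h', n, hn⟩ | ⟨-, -, h, -⟩)
      · refine Or.inl ⟨h, fun hxs => absurd (h' hxs).2 (lt_irrefl _), n + 1, ?_⟩
        push_cast
        rw [hn]
        ring
      · linarith
  | edgeC y hy =>
    have h1 : 0 ≤ s * (y - s) := mul_nonneg hs0.le (by linarith [hy.1])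
    simp only at *
    constructor
    · rintro (⟨h, -⟩ | ⟨h, -⟩) <;> linarith
    · rintro (⟨h, -⟩ | ⟨-, -, h, -⟩) <;> linarith
  | edgeD x hx =>
    have h1 := hx.2
    simp only at *
    constructor
    · rintro (⟨h, -⟩ | ⟨-, -, h, -⟩) <;> linarith
    · rintro (⟨h, -⟩ | ⟨-, -, h, -⟩) <;> linarith

theorem horizontal_eq_of_edgeGlue {s : ℝ} (hs0 : 0 < s) (hs1 : s < 1) {p q : ℝ × ℝ}
    (h : EdgeGlue s p q) : horizontal s p = horizontal s q := by
  cases h with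
  | edgeA y hy =>
    have h1 : s ≠ -s := by linarith
    have h2 : (0 : ℝ) ≠ -s := by linarith
    have h3 : 0 < s * y ↔ 0 < y := by simp [hs0]
    have h4 : s * y < s ↔ y < 1 := by
      constructor
      · intro h
        by_contra hc
        nlinarith
      · intro h
        nlinarith
    by_cases hy' : 0 < y ∧ y < 1
    · simp [horizontal, h1, hs0.ne', hy', h3, h4]
    · simp [horizontal, h1, hs0.ne', hs0.ne, h3, h4, hy']
  | edgeB x hx =>
    have h1 : x ≠ -s := by linarith [hx.1]
    simp [horizontal, h1, hs1.le, not_lt.mpr]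
  | edgeC y hy =>
    have h1 : 0 ≤ s * (y - s) := mul_nonneg hs0.le (by linarith [hy.1])
    have h3 : ¬ (1 + s * (y - s) < s) := by linarith
    simp [horizontal, hs0.ne, h3]
  | edgeD x hx =>
    have h1 : x ≠ s := by linarith [hx.2]
    have h2 : ¬ (1 + s < s) := by linarith
    simp [horizontal, h1, h2]

theorem crossing_eq_of_proj_eq {s : ℝ} (hs0 : 0 < s) (hs1 : s < 1) (m : ℝ) {p q : octagon s}
    (h : HomSurface.proj s p = HomSurface.proj s q) :
    crossing s m (p : ℝ × ℝ) = crossing s m (q : ℝ × ℝ) :=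
  congrArg (Quot.lift (fun p : octagon s => crossing s m (p : ℝ × ℝ))
    fun _ _ => crossing_eq_of_edgeGlue hs0 hs1 m) h

theorem horizontal_eq_of_proj_eq {s : ℝ} (hs0 : 0 < s) (hs1 : s < 1) {p q : octagon s}
    (h : HomSurface.proj s p = HomSurface.proj s q) :
    horizontal s (p : ℝ × ℝ) = horizontal s (q : ℝ × ℝ) :=
  congrArg (Quot.lift (fun p : octagon s => horizontal s (p : ℝ × ℝ))
    fun _ _ => horizontal_eq_of_edgeGlue hs0 hs1) h

/-- `crossing` as a function on the surface. -/
def surfaceCrossing (s m : ℝ) (x : HomSurface s) : Set ℝ :=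
  {r | ∃ p : octagon s, x = HomSurface.proj s p ∧ r ∈ crossing s m p}

/-- `horizontal` as a relation on the surface. -/
def HasHorizontal (s : ℝ) (x : HomSurface s) (a : ℝ) : Prop :=
  ∃ p : octagon s, x = HomSurface.proj s p ∧ a = horizontal s p

theorem surfaceCrossing_proj {s : ℝ} (hs0 : 0 < s) (hs1 : s < 1) (m : ℝ) (p : octagon s) :
    surfaceCrossing s m (HomSurface.proj s p) = crossing s m p := by
  ext r
  constructor
  · rintro ⟨q, hq, hr⟩
    rwa [crossing_eq_of_proj_eq hs0 hs1 m hq]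
  · exact fun hr => ⟨p, rfl, hr⟩

theorem HasHorizontal.unique {s : ℝ} (hs0 : 0 < s) (hs1 : s < 1) {x : HomSurface s} {a b : ℝ}
    (ha : HasHorizontal s x a) (hb : HasHorizontal s x b) : a = b := by
  obtain ⟨p, rfl, rfl⟩ := ha
  obtain ⟨q, hq, rfl⟩ := hb
  exact horizontal_eq_of_proj_eq hs0 hs1 hq

/-! ### The functions in the charts -/

theorem fst_snd_of_mem_interior_octagon {s : ℝ} {q : ℝ × ℝ}
    (hq : q ∈ interior (octagon s)) :
    (0 < q.1 ∧ q.1 < s) ∨ (-s < q.1 ∧ q.1 < 0) ∨ (q.1 = 0 ∧ s < q.2 ∧ q.2 < 1) := by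
  obtain ⟨ε, hε, hb⟩ := Metric.mem_nhds_iff.1 (mem_interior_iff_mem_nhds.1 hq)
  have key : ∀ a b : ℝ, |a| < ε → |b| < ε → (q.1 + a, q.2 + b) ∈ octagon s := by
    intro a b ha hb'
    apply hb
    rw [Metric.mem_ball, Prod.dist_eq]
    simp [ha, hb']
  have h1 : |ε / 2| < ε := by rw [abs_of_pos (by linarith)]; linarith
  have h2 : |-(ε / 2)| < ε := by rwa [abs_neg]
  rcases lt_trichotomy q.1 0 with hx | hx | hx
  · right; left
    rcases key _ _ h2 h1 with ⟨h, -⟩ | ⟨h, -⟩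
    · linarith [h.1]
    · exact ⟨by linarith [h.1], hx⟩
  -- Nearby points to the left can only lie in `R⁻`, which bounds the height below by `s`; those to
  -- the right can only lie in `R⁺`, which bounds it above by `1`.
  · right; right
    refine ⟨hx, ?_, ?_⟩
    · rcases key _ _ h2 h2 with ⟨h, -⟩ | ⟨-, h⟩
      · linarith [h.1]
      · linarith [h.1]
    · rcases key _ _ h1 h1 with ⟨-, h⟩ | ⟨h, -⟩
      · linarith [h.2]
      · linarith [h.2]
  · left
    rcases key _ _ h1 h1 with ⟨h, -⟩ | ⟨h, -⟩
    · exact ⟨hx, by linarith [h.2]⟩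
    · linarith [h.2]

theorem crossing_of_pos_of_lt {s m : ℝ} {p : ℝ × ℝ} (h0 : 0 < p.1) (h1 : p.1 < s) :
    crossing s m p = intTranslates (p.2 - m * p.1) := by
  ext r
  simp [crossing, intTranslates, h0, h0.ne', h1.ne]

theorem crossing_of_neg {s m : ℝ} {p : ℝ × ℝ} (h0 : p.1 < 0) : crossing s m p = ∅ := by
  ext r
  simp [crossing, h0.not_gt, h0.ne]

open Classical in
/-- The function `crossing` in the charts. -/
noncomputable def chartCrossing (s m : ℝ) : ChartName → ℝ × ℝ → Set ℝ
  | .inner, q => if 0 < q.1 then intTranslates (q.2 - m * q.1) else ∅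
  | .A, q => if q.1 ≤ s then intTranslates (q.2 - m * q.1)
      else intTranslates (s * (q.2 - m * q.1 + m * s))
  | .B, q => intTranslates (q.2 - m * q.1)
  | .C, _ => ∅
  | .D, _ => ∅

theorem crossing_chartFold {s : ℝ} (hs0 : 0 < s) (m : ℝ) (k : ChartName)
    {q : ℝ × ℝ} (hq : q ∈ chartDomain s k) :
    crossing s m (chartFold s k q) = chartCrossing s m k q := by
  cases k with
  | inner =>
    simp only [chartFold, chartCrossing]
    rcases fst_snd_of_mem_interior_octagon hq with ⟨h1, h2⟩ | ⟨h1, h2⟩ | ⟨h1, h2, h3⟩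
    · rw [if_pos h1, crossing_of_pos_of_lt h1 h2]
    · rw [if_neg h2.not_gt, crossing_of_neg h2]
    · ext r
      simp [crossing, h1, h2.not_gt]
  | A =>
    obtain ⟨⟨h1, h2⟩, h3, h4⟩ := hq
    simp only [chartFold, chartCrossing]
    split_ifs with h
    · rcases h.lt_or_eq with h | h
      · exact crossing_of_pos_of_lt (by linarith) h
      · ext r
        simp [crossing, intTranslates, h, hs0, hs0.ne', h3, h4]
    · push Not at h
      rw [crossing_of_pos_of_lt]
      · congr 1
        simp only
        ring
      · exact mul_pos hs0 (by linarith)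
      · simp only
        nlinarith
  | B =>
    obtain ⟨⟨h1, h2⟩, h3, h4⟩ := hq
    simp only [chartFold, chartCrossing]
    split_ifs with h
    · exact crossing_of_pos_of_lt h1 h2
    · rw [crossing_of_pos_of_lt (p := (q.1, q.2 - 1)) h1 h2]
      ext r
      constructor
      · rintro ⟨n, hn⟩
        exact ⟨n - 1, by push_cast; rw [hn]; ring⟩
      · rintro ⟨n, hn⟩
        exact ⟨n + 1, by push_cast; rw [hn]; ring⟩
  | C =>
    obtain ⟨⟨h1, h2⟩, h3, h4⟩ := hq
    simp only [chartFold, chartCrossing]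
    split_ifs with h
    · exact crossing_of_neg (by linarith)
    · exact crossing_of_neg (mul_neg_of_pos_of_neg hs0 (by linarith))
  | D =>
    obtain ⟨⟨h1, h2⟩, h3, h4⟩ := hq
    simp only [chartFold, chartCrossing]
    split_ifs with h
    · exact crossing_of_neg h2
    · exact crossing_of_neg h2

open Classical in
/-- The function `horizontal` in the charts. -/
noncomputable def chartHorizontal (s : ℝ) : ChartName → ℝ → ℝ
  | .A, x => if x ≤ s then x else s * (x - s)
  | .C, x => if -s < x then x else s * (x + s)
  | _, x => x

theorem horizontal_of_mem_Ioo {s : ℝ} {p : ℝ × ℝ} (h1 : -s < p.1) (h2 : p.1 < s)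
    (h0 : p.1 ≠ 0) : horizontal s p = p.1 := by
  simp [horizontal, h1.ne', h2.ne, h0]

theorem horizontal_chartFold {s : ℝ} (hs0 : 0 < s) (hs1 : s < 1) (k : ChartName)
    {q : ℝ × ℝ} (hq : q ∈ chartDomain s k) :
    horizontal s (chartFold s k q) = chartHorizontal s k q.1 := by
  cases k with
  | inner =>
    simp only [chartFold, chartHorizontal]
    rcases fst_snd_of_mem_interior_octagon hq with ⟨h1, h2⟩ | ⟨h1, h2⟩ | ⟨h1, h2, h3⟩
    · exact horizontal_of_mem_Ioo (by linarith) h2 h1.ne'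
    · exact horizontal_of_mem_Ioo h1 (by linarith) h2.ne
    · simp [horizontal, h1, h2.not_gt, hs0.ne, hs0.ne']
  | A =>
    obtain ⟨⟨h1, h2⟩, h3, h4⟩ := hq
    simp only [chartFold, chartHorizontal]
    split_ifs with h
    · rcases h.lt_or_eq with h | h
      · exact horizontal_of_mem_Ioo (by linarith) h (by linarith)
      · have : s ≠ -s := by linarith
        simp [horizontal, h, this, hs0.ne', h3, h4]
    · push Not at h
      have : 0 < s * (q.1 - s) := mul_pos hs0 (by linarith)
      exact horizontal_of_mem_Ioo (by simp only; linarith) (by simp only; nlinarith) this.ne'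
  | B =>
    obtain ⟨⟨h1, h2⟩, h3, h4⟩ := hq
    simp only [chartFold, chartHorizontal]
    split_ifs with h
    · exact horizontal_of_mem_Ioo (by linarith) h2 h1.ne'
    · exact horizontal_of_mem_Ioo (by simp only; linarith) h2 h1.ne'
  | C =>
    obtain ⟨⟨h1, h2⟩, h3, h4⟩ := hq
    simp only [chartFold, chartHorizontal]
    rcases lt_trichotomy q.1 (-s) with h | h | h
    · rw [if_neg h.not_ge, if_neg h.not_gt]
      have : s * (q.1 + s) < 0 := mul_neg_of_pos_of_neg hs0 (by linarith)
      exact horizontal_of_mem_Ioo (by simp only; nlinarith) (by simp only; linarith) this.ne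
    · simp [horizontal, h]
    · rw [if_pos h.le, if_pos h]
      exact horizontal_of_mem_Ioo h (by linarith) (by linarith)
  | D =>
    obtain ⟨⟨h1, h2⟩, h3, h4⟩ := hq
    simp only [chartFold, chartHorizontal]
    split_ifs with h
    · exact horizontal_of_mem_Ioo h1 (by linarith) h2.ne
    · exact horizontal_of_mem_Ioo h1 (by simp only; linarith) h2.ne

theorem HasCoord.surfaceCrossing_eq {s : ℝ} (hs0 : 0 < s) (hs1 : s < 1) (m : ℝ) {k : ChartName}
    {q : ℝ × ℝ} {x : HomSurface s} (h : HasCoord s k q x) :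
    surfaceCrossing s m x = chartCrossing s m k q := by
  obtain ⟨hq, p, hp, rfl⟩ := h
  rw [surfaceCrossing_proj hs0 hs1, hp, crossing_chartFold hs0 m k hq]

theorem HasCoord.hasHorizontal {s : ℝ} (hs0 : 0 < s) (hs1 : s < 1) {k : ChartName}
    {q : ℝ × ℝ} {x : HomSurface s} (h : HasCoord s k q x) :
    HasHorizontal s x (chartHorizontal s k q.1) := by
  obtain ⟨hq, p, hp, rfl⟩ := h
  exact ⟨p, rfl, by rw [hp, horizontal_chartFold hs0 hs1 k hq]⟩

/-- The coordinate may jump at the seam of the charts `A` and `C`, but the gluings are direct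
homotheties, so it increases on each side. This detects the sign of the speed without computing
transition maps. -/
theorem exists_strictMonoOn_chartHorizontal {s : ℝ} (hs0 : 0 < s) (k : ChartName) (x : ℝ) :
    ∃ ε > 0, StrictMonoOn (chartHorizontal s k) (Ioo (x - ε) x) ∧
      StrictMonoOn (chartHorizontal s k) (Ioo x (x + ε)) := by
  have main : ∀ b : ℝ, ∃ ε > 0, (Ioo (x - ε) x ⊆ Iio b ∨ Ioo (x - ε) x ⊆ Ioi b) ∧
      (Ioo x (x + ε) ⊆ Iio b ∨ Ioo x (x + ε) ⊆ Ioi b) := by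
    intro b
    rcases lt_trichotomy x b with h | h | h
    · exact ⟨b - x, by linarith, Or.inl fun y hy => hy.2.trans h,
        Or.inl fun y hy => by have := hy.2; simp only [mem_Iio]; linarith⟩
    · exact ⟨1, one_pos, Or.inl fun y hy => by have := hy.2; simp only [mem_Iio]; linarith,
        Or.inr fun y hy => by have := hy.1; simp only [mem_Ioi]; linarith⟩
    · exact ⟨x - b, by linarith,
        Or.inr fun y hy => by have := hy.1; simp only [mem_Ioi]; linarith,
        Or.inr fun y hy => h.trans hy.1⟩
  have mono : ∀ b, StrictMonoOn (chartHorizontal s k) (Iio b) →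
      StrictMonoOn (chartHorizontal s k) (Ioi b) →
      ∃ ε > 0, StrictMonoOn (chartHorizontal s k) (Ioo (x - ε) x) ∧
      StrictMonoOn (chartHorizontal s k) (Ioo x (x + ε)) := by
    intro b h1 h2
    obtain ⟨ε, hε, hl, hr⟩ := main b
    exact ⟨ε, hε, hl.elim h1.mono h2.mono, hr.elim h1.mono h2.mono⟩
  cases k with
  | inner => exact ⟨1, one_pos, fun _ _ _ _ h => h, fun _ _ _ _ h => h⟩
  | A =>
    refine mono s (fun a ha b hb h => ?_) (fun a ha b hb h => ?_)
    · simp only [mem_Iio] at ha hb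
      simpa [chartHorizontal, ha.le, hb.le] using h
    · simp only [mem_Ioi] at ha hb
      simp only [chartHorizontal, if_neg ha.not_ge, if_neg hb.not_ge]
      nlinarith
  | B => exact ⟨1, one_pos, fun _ _ _ _ h => h, fun _ _ _ _ h => h⟩
  | C =>
    refine mono (-s) (fun a ha b hb h => ?_) (fun a ha b hb h => ?_)
    · simp only [mem_Iio] at ha hb
      simp only [chartHorizontal, if_neg ha.not_gt, if_neg hb.not_gt]
      nlinarith
    · simp only [mem_Ioi] at ha hb
      simp only [chartHorizontal, if_pos ha, if_pos hb]
      exact h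
  | D => exact ⟨1, one_pos, fun _ _ _ _ h => h, fun _ _ _ _ h => h⟩

/-- The first return to the right-hand side of `R⁺`, in terms of `crossing`. -/
def advance (s m : ℝ) (S : Set ℝ) : Set ℝ :=
  {r | ∃ h ∈ S, 0 ≤ h + m * s ∧ h + m * s ≤ 1 ∧ ∃ n : ℤ, r = s * (h + m * s) + n}

theorem advance_mono (s m : ℝ) : Monotone (advance s m) :=
  fun _ _ hST _ ⟨h, hh, h'⟩ => ⟨h, hST hh, h'⟩

theorem mem_intTranslates_self (a : ℝ) : a ∈ intTranslates a := ⟨0, by simp⟩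

/-- At a seam the value is the one seen from the left, so the crossing is constant on a left
neighbourhood of every point. This includes the points of `E`, where it is still empty. -/
theorem eventually_chartCrossing_left (s m : ℝ) (k : ChartName) (q : ℝ × ℝ) :
    ∀ᶠ δ in 𝓝[<] (0 : ℝ),
      chartCrossing s m k (q + δ • ((1 : ℝ), m)) = chartCrossing s m k q := by
  have inv : ∀ δ : ℝ, q.2 + δ * m - m * (q.1 + δ) = q.2 - m * q.1 := fun δ => by ring
  have hneg : ∀ᶠ δ in 𝓝[<] (0 : ℝ), δ < 0 := eventually_mem_nhdsWithin
  have hgt : ∀ b : ℝ, b < q.1 → ∀ᶠ δ in 𝓝[<] (0 : ℝ), b < q.1 + δ := fun b hb => by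
    have : ∀ᶠ δ in 𝓝 (0 : ℝ), b - q.1 < δ := eventually_gt_nhds (by linarith)
    filter_upwards [this.filter_mono nhdsWithin_le_nhds] with δ hδ
    linarith
  cases k with
  | inner =>
    rcases lt_or_ge 0 q.1 with h | h
    · filter_upwards [hgt 0 h] with δ hδ
      simp [chartCrossing, h, hδ, inv]
    · filter_upwards [hneg] with δ hδ
      have : ¬ 0 < q.1 + δ := by linarith
      simp [chartCrossing, h.not_gt, this]
  | A =>
    rcases lt_or_ge s q.1 with h | h
    · filter_upwards [hgt s h] with δ hδ
      simp [chartCrossing, h.not_ge, hδ.not_ge, inv]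
    · filter_upwards [hneg] with δ hδ
      have : q.1 + δ ≤ s := by linarith
      simp [chartCrossing, h, this, inv]
  | B => exact Eventually.of_forall fun δ => by simp [chartCrossing, inv]
  | C => exact Eventually.of_forall fun δ => rfl
  | D => exact Eventually.of_forall fun δ => rfl

/-- The value changes only on leaving the edge `A`, and the change is one step of the first return.
Entry into `R⁺` through `E` would be another change, but there the crossing is empty, which `hne`
excludes. -/
theorem eventually_chartCrossing_right (s m : ℝ) (k : ChartName) {q : ℝ × ℝ}
    (hq : q ∈ chartDomain s k) (hne : (chartCrossing s m k q).Nonempty) :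
    ∀ᶠ δ in 𝓝[>] (0 : ℝ), (chartCrossing s m k (q + δ • ((1 : ℝ), m))).Nonempty ∧
      chartCrossing s m k (q + δ • ((1 : ℝ), m)) ⊆
        chartCrossing s m k q ∪ advance s m (chartCrossing s m k q) := by
  have inv : ∀ δ : ℝ, q.2 + δ * m - m * (q.1 + δ) = q.2 - m * q.1 := fun δ => by ring
  have hpos : ∀ᶠ δ in 𝓝[>] (0 : ℝ), 0 < δ := eventually_mem_nhdsWithin
  have same : ∀ δ : ℝ, chartCrossing s m k (q + δ • ((1 : ℝ), m)) = chartCrossing s m k q →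
      (chartCrossing s m k (q + δ • ((1 : ℝ), m))).Nonempty ∧
      chartCrossing s m k (q + δ • ((1 : ℝ), m)) ⊆
        chartCrossing s m k q ∪ advance s m (chartCrossing s m k q) := fun δ h => by
    rw [h]
    exact ⟨hne, subset_union_left⟩
  cases k with
  | inner =>
    have h : 0 < q.1 := by
      by_contra h
      simp [chartCrossing, h] at hne
    filter_upwards [hpos] with δ hδ
    refine same δ ?_
    have : 0 < q.1 + δ := by linarith
    simp [chartCrossing, h, this, inv]
  | A =>
    obtain ⟨-, h3, h4⟩ := hq
    rcases lt_trichotomy q.1 s with h | h | h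
    · have : ∀ᶠ δ in 𝓝 (0 : ℝ), δ < s - q.1 := eventually_lt_nhds (by linarith)
      filter_upwards [this.filter_mono nhdsWithin_le_nhds] with δ hδ
      refine same δ ?_
      have : q.1 + δ ≤ s := by linarith
      simp [chartCrossing, h.le, this, inv]
    · filter_upwards [hpos] with δ hδ
      have h' : ¬ q.1 + δ ≤ s := by linarith
      have e : chartCrossing s m .A (q + δ • ((1 : ℝ), m)) =
          intTranslates (s * (q.2 - m * q.1 + m * s)) := by
        simp [chartCrossing, h', inv]
      rw [e]
      refine ⟨⟨_, mem_intTranslates_self _⟩, fun r hr => Or.inr ?_⟩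
      -- Since `q.1 = s`, adding `m * s` to this height gives `q.2`, the height on the right-hand
      -- side, which lies in `(0, 1)`.
      refine ⟨q.2 - m * q.1, ?_, ?_, ?_, hr⟩
      · simp only [chartCrossing, h.le, if_true]
        exact mem_intTranslates_self _
      · rw [h]; linarith
      · rw [h]; linarith
    · filter_upwards [hpos] with δ hδ
      refine same δ ?_
      have h' : ¬ q.1 + δ ≤ s := by linarith
      simp [chartCrossing, h.not_ge, h', inv]
  | B => exact Eventually.of_forall fun δ => same δ (by simp [chartCrossing, inv])
  | C => exact absurd hne (by simp [chartCrossing])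
  | D => exact absurd hne (by simp [chartCrossing])

/-! ### Locally affine curves -/

/-- In local coordinates, `τ` is affine on `J` with direction `v` and a speed that satisfies
`P`. -/
def LocallyAffine (s : ℝ) (P : ℝ → Prop) (v : ℝ × ℝ) (J : Set ℝ) (τ : ℝ → HomSurface s) : Prop :=
  ∀ t ∈ J, ∃ (k : ChartName) (q : ℝ × ℝ) (c : ℝ), P c ∧
    ∀ᶠ u in 𝓝 t, HasCoord s k (q + ((u - t) * c) • v) (τ u)

theorem LocallyAffine.smul {s : ℝ} {v : ℝ × ℝ} {J : Set ℝ} {τ : ℝ → HomSurface s} {a : ℝ}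
    (h : LocallyAffine s (· ≠ 0) (a • v) J τ) (ha : a ≠ 0) : LocallyAffine s (· ≠ 0) v J τ := by
  intro t ht
  obtain ⟨k, q, c, hc, hu⟩ := h t ht
  refine ⟨k, q, c * a, mul_ne_zero hc ha, hu.mono fun u hu => ?_⟩
  rwa [smul_smul, mul_assoc] at hu

theorem LocallyAffine.comp_neg {s : ℝ} {v : ℝ × ℝ} {J : Set ℝ} {τ : ℝ → HomSurface s}
    (h : LocallyAffine s (· < 0) v J τ) :
    LocallyAffine s (0 < ·) v (-J) (fun t => τ (-t)) := by
  intro t ht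
  obtain ⟨k, q, c, hc, hu⟩ := h (-t) ht
  have hc' : c < 0 := hc
  refine ⟨k, q, -c, neg_pos.2 hc', ?_⟩
  have := (continuous_neg.tendsto t).eventually hu
  refine this.mono fun u hu => ?_
  convert hu using 3
  ring

/-- The speed of a non-vertical locally affine curve does not change sign. -/
theorem LocallyAffine.pos_or_neg {s : ℝ} (hs0 : 0 < s) (hs1 : s < 1) {m : ℝ} {J : Set ℝ}
    (hJ : IsPreconnected J) {τ : ℝ → HomSurface s} (h : LocallyAffine s (· ≠ 0) (1, m) J τ) :
    LocallyAffine s (0 < ·) (1, m) J τ ∨ LocallyAffine s (· < 0) (1, m) J τ := by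
  -- The times with a positive and with a negative speed form two disjoint open sets that cover the
  -- connected set `J`.
  let R : (ℝ → Prop) → Set ℝ := fun P => {t | ∃ (k : ChartName) (q : ℝ × ℝ) (c : ℝ), P c ∧
    ∀ᶠ u in 𝓝 t, HasCoord s k (q + ((u - t) * c) • ((1 : ℝ), m)) (τ u)}
  have hopen : ∀ P, IsOpen (R P) := by
    intro P
    rw [isOpen_iff_mem_nhds]
    rintro t ⟨k, q, c, hc, hu⟩
    filter_upwards [eventually_eventually_nhds.2 hu] with t' ht'
    refine ⟨k, q + ((t' - t) * c) • ((1 : ℝ), m), c, hc, ht'.mono fun u hu => ?_⟩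
    convert hu using 1
    rw [add_assoc, ← add_smul]
    congr 2
    ring
  -- With speeds of both signs at `t`, the same horizontal coordinate would be both strictly
  -- increasing and strictly decreasing just after `t`; it is compared at the times `t + ζ / 2` and
  -- `t + ζ`.
  have hdisj : ∀ t, t ∈ R (0 < ·) → t ∈ R (· < 0) → False := by
    rintro t ⟨k, q, c, hc, hu⟩ ⟨k', q', c', hc', hu'⟩
    have hc1 : 0 < c := hc
    have hc1' : c' < 0 := hc'
    obtain ⟨ε, hε, -, hmono⟩ := exists_strictMonoOn_chartHorizontal hs0 k q.1
    obtain ⟨ε', hε', hmono', -⟩ := exists_strictMonoOn_chartHorizontal hs0 k' q'.1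
    obtain ⟨η, hη, hball⟩ := Metric.eventually_nhds_iff.1 (hu.and hu')
    obtain ⟨ζ, hζ0, hζ⟩ : ∃ ζ > 0, ζ < η ∧ ζ * c < ε ∧ ζ * (-c') < ε' := by
      have h1 : ∀ᶠ ζ in 𝓝 (0 : ℝ), ζ < η := eventually_lt_nhds hη
      have h2 : ∀ᶠ ζ in 𝓝 (0 : ℝ), ζ * c < ε :=
        (show Continuous fun ζ : ℝ => ζ * c by fun_prop).tendsto' 0 0 (by simp)
          |>.eventually (eventually_lt_nhds hε)
      have h3 : ∀ᶠ ζ in 𝓝 (0 : ℝ), ζ * (-c') < ε' :=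
        (show Continuous fun ζ : ℝ => ζ * (-c') by fun_prop).tendsto' 0 0 (by simp)
          |>.eventually (eventually_lt_nhds hε')
      have h4 : ∀ᶠ ζ in 𝓝[>] (0 : ℝ), 0 < ζ := eventually_mem_nhdsWithin
      obtain ⟨ζ, h, h'⟩ := (h4.and ((h1.and (h2.and h3)).filter_mono nhdsWithin_le_nhds)).exists
      exact ⟨ζ, h, h'⟩
    have at_time : ∀ r, 0 < r → r ≤ ζ →
        chartHorizontal s k (q.1 + r * c) = chartHorizontal s k' (q'.1 + r * c') := by
      intro r hr hrζ
      have hd : dist (t + r) t < η := by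
        rw [Real.dist_eq, add_sub_cancel_left, abs_of_pos hr]
        linarith [hζ.1]
      obtain ⟨h1, h2⟩ := hball hd
      have h3 := (h1.hasHorizontal hs0 hs1).unique hs0 hs1 (h2.hasHorizontal hs0 hs1)
      simpa using h3
    have e1 := at_time ζ hζ0 le_rfl
    have e2 := at_time (ζ / 2) (by linarith) (by linarith)
    have p1 : 0 < ζ * c := mul_pos hζ0 hc1
    have p2 : 0 < ζ * (-c') := mul_pos hζ0 (by linarith)
    have l1 := hmono (a := q.1 + ζ / 2 * c) (b := q.1 + ζ * c)
      ⟨by linarith, by linarith [hζ.2.1]⟩ ⟨by linarith, by linarith [hζ.2.1]⟩ (by linarith)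
    have l2 := hmono' (a := q'.1 + ζ * c') (b := q'.1 + ζ / 2 * c')
      ⟨by linarith [hζ.2.2], by linarith⟩ ⟨by linarith [hζ.2.2], by linarith⟩ (by linarith)
    linarith
  have hcover : J ⊆ R (0 < ·) ∪ R (· < 0) := by
    intro t ht
    obtain ⟨k, q, c, hc, hu⟩ := h t ht
    rcases lt_or_gt_of_ne hc with hc | hc
    · exact Or.inr ⟨k, q, c, hc, hu⟩
    · exact Or.inl ⟨k, q, c, hc, hu⟩
  exact hJ.subset_or_subset (hopen _) (hopen _)
    (disjoint_left.2 fun t h1 h2 => hdisj t h1 h2) hcover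

/-! ### Heights along a trajectory that moves to the right -/

theorem tendsto_sub_mul_nhdsLT {c : ℝ} (hc : 0 < c) (t : ℝ) :
    Tendsto (fun u => (u - t) * c) (𝓝[<] t) (𝓝[<] 0) := by
  refine tendsto_nhdsWithin_iff.2 ⟨?_, ?_⟩
  · exact ((show Continuous fun u : ℝ => (u - t) * c by fun_prop).tendsto' t 0
      (by simp)).mono_left nhdsWithin_le_nhds
  · filter_upwards [eventually_mem_nhdsWithin] with u hu
    exact mul_neg_of_neg_of_pos (sub_neg.2 hu) hc

theorem tendsto_sub_mul_nhdsGT {c : ℝ} (hc : 0 < c) (t : ℝ) :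
    Tendsto (fun u => (u - t) * c) (𝓝[>] t) (𝓝[>] 0) := by
  refine tendsto_nhdsWithin_iff.2 ⟨?_, ?_⟩
  · exact ((show Continuous fun u : ℝ => (u - t) * c by fun_prop).tendsto' t 0
      (by simp)).mono_left nhdsWithin_le_nhds
  · filter_upwards [eventually_mem_nhdsWithin] with u hu
    exact mul_pos (sub_pos.2 hu) hc

theorem LocallyAffine.eventually_left {s : ℝ} (hs0 : 0 < s) (hs1 : s < 1) {m : ℝ} {J : Set ℝ}
    {τ : ℝ → HomSurface s} (h : LocallyAffine s (0 < ·) (1, m) J τ) {t : ℝ} (ht : t ∈ J) :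
    ∀ᶠ u in 𝓝[<] t, surfaceCrossing s m (τ u) = surfaceCrossing s m (τ t) := by
  obtain ⟨k, q, c, hc, hu⟩ := h t ht
  have h0 := hu.self_of_nhds
  simp only [sub_self, zero_mul, zero_smul, add_zero] at h0
  filter_upwards [hu.filter_mono nhdsWithin_le_nhds,
    (tendsto_sub_mul_nhdsLT hc t).eventually (eventually_chartCrossing_left s m k q)] with u h1 h2
  rw [h1.surfaceCrossing_eq hs0 hs1, h0.surfaceCrossing_eq hs0 hs1, h2]

theorem LocallyAffine.eventually_right {s : ℝ} (hs0 : 0 < s) (hs1 : s < 1) {m : ℝ} {J : Set ℝ}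
    {τ : ℝ → HomSurface s} (h : LocallyAffine s (0 < ·) (1, m) J τ) {t : ℝ} (ht : t ∈ J)
    (hne : (surfaceCrossing s m (τ t)).Nonempty) :
    ∀ᶠ u in 𝓝[>] t, (surfaceCrossing s m (τ u)).Nonempty ∧ surfaceCrossing s m (τ u) ⊆
      surfaceCrossing s m (τ t) ∪ advance s m (surfaceCrossing s m (τ t)) := by
  obtain ⟨k, q, c, hc, hu⟩ := h t ht
  have h0 := hu.self_of_nhds
  simp only [sub_self, zero_mul, zero_smul, add_zero] at h0
  rw [h0.surfaceCrossing_eq hs0 hs1] at hne ⊢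
  filter_upwards [hu.filter_mono nhdsWithin_le_nhds, (tendsto_sub_mul_nhdsGT hc t).eventually
    (eventually_chartCrossing_right s m k h0.1 hne)] with u h1 h2
  rwa [h1.surfaceCrossing_eq hs0 hs1]

/-- At the infimum of the failures `P` holds by `hl`, or by `ha` if the infimum is `a`; then `hr`
carries `P` past the infimum, a contradiction. -/
theorem real_induction {P : ℝ → Prop} {a b : ℝ} (hab : a ≤ b) (ha : P a)
    (hl : ∀ x ∈ Ioc a b, (∀ y ∈ Ico a x, P y) → P x)
    (hr : ∀ x ∈ Ico a b, P x → ∀ᶠ y in 𝓝[>] x, P y) : P b := by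
  by_contra hb
  let B : Set ℝ := {x | x ∈ Icc a b ∧ ¬ P x}
  have hBb : b ∈ B := ⟨⟨hab, le_rfl⟩, hb⟩
  have hbdd : BddBelow B := ⟨a, fun x hx => hx.1.1⟩
  have h1 : a ≤ sInf B := le_csInf ⟨b, hBb⟩ fun x hx => hx.1.1
  have h2 : sInf B ≤ b := csInf_le hbdd hBb
  have h3 : ∀ y ∈ Ico a (sInf B), P y := fun y hy => by
    by_contra hc
    exact absurd (csInf_le hbdd (show y ∈ B from ⟨⟨hy.1, hy.2.le.trans h2⟩, hc⟩)) hy.2.not_ge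
  have h4 : P (sInf B) := by
    rcases h1.eq_or_lt with h | h
    · rwa [← h]
    · exact hl _ ⟨h, h2⟩ h3
  have h5 : sInf B < b := lt_of_le_of_ne h2 fun h => hb (h ▸ h4)
  obtain ⟨d, hd, hd'⟩ := mem_nhdsGT_iff_exists_Ioo_subset.1 (hr _ ⟨h1, h5⟩ h4)
  obtain ⟨x, hx, hxd⟩ := exists_lt_of_csInf_lt ⟨b, hBb⟩ (show sInf B < d from hd)
  refine hx.2 ?_
  rcases (csInf_le hbdd hx).eq_or_lt with h | h
  · rwa [← h]
  · exact hd' ⟨h, hxd⟩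

/-- The set of values of `crossing` along a curve. -/
def crossingSet (s m : ℝ) (J : Set ℝ) (τ : ℝ → HomSurface s) : Set ℝ :=
  ⋃ t ∈ J, surfaceCrossing s m (τ t)

/-- Real induction on time: constancy from the left gives the limit step, and to the right only an
`advance` can be added. Nonemptiness is carried along because it expresses that the curve is trapped
in `R⁺`. -/
theorem LocallyAffine.crossing_subset {s : ℝ} (hs0 : 0 < s) (hs1 : s < 1) {m : ℝ} {J : Set ℝ}
    (hJ : J.OrdConnected) {τ : ℝ → HomSurface s} (h : LocallyAffine s (0 < ·) (1, m) J τ)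
    {a b : ℝ} (ha : a ∈ J) (hb : b ∈ J) (hab : a ≤ b)
    (hne : (surfaceCrossing s m (τ a)).Nonempty) :
    surfaceCrossing s m (τ b) ⊆
      surfaceCrossing s m (τ a) ∪ advance s m (crossingSet s m J τ) := by
  have hsub : Icc a b ⊆ J := hJ.out ha hb
  have key : (surfaceCrossing s m (τ b)).Nonempty ∧ surfaceCrossing s m (τ b) ⊆
      surfaceCrossing s m (τ a) ∪ advance s m (crossingSet s m J τ) := by
    refine real_induction (P := fun x => (surfaceCrossing s m (τ x)).Nonempty ∧
      surfaceCrossing s m (τ x) ⊆ surfaceCrossing s m (τ a) ∪ advance s m (crossingSet s m J τ))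
      hab ⟨hne, subset_union_left⟩ (fun x hx hP => ?_) (fun x hx hP => ?_)
    · have h1 := h.eventually_left hs0 hs1 (hsub ⟨hx.1.le, hx.2⟩)
      have h2 : ∀ᶠ y in 𝓝[<] x, y ∈ Ico a x := Ico_mem_nhdsLT hx.1
      obtain ⟨y, hy, hy'⟩ := (h1.and h2).exists
      simpa only [hy] using hP y hy'
    · have hxJ := hsub ⟨hx.1, hx.2.le⟩
      filter_upwards [h.eventually_right hs0 hs1 hxJ hP.1] with y hy
      refine ⟨hy.1, hy.2.trans (union_subset hP.2 ?_)⟩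
      refine (advance_mono s m ?_).trans subset_union_right
      exact subset_biUnion_of_mem (u := fun t => surfaceCrossing s m (τ t)) hxJ
  exact key.2

theorem sub_mem_of_mem_crossing {s m : ℝ} {p : ℝ × ℝ} {r r' : ℝ} (hr : r ∈ crossing s m p)
    (hr' : r' ∈ crossing s m p) : ∃ n : ℤ, r = r' + n := by
  rcases hr with ⟨h0, -, n, rfl⟩ | ⟨h0, -, -, n, rfl⟩ <;>
  rcases hr' with ⟨h0', -, n', rfl⟩ | ⟨h0', -, -, n', rfl⟩
  · exact ⟨n - n', by push_cast; ring⟩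
  · linarith
  · linarith
  · exact ⟨n - n', by push_cast; ring⟩

theorem sub_mem_of_mem_surfaceCrossing {s : ℝ} (hs0 : 0 < s) (hs1 : s < 1) {m : ℝ}
    {x : HomSurface s} {r r' : ℝ} (hr : r ∈ surfaceCrossing s m x)
    (hr' : r' ∈ surfaceCrossing s m x) : ∃ n : ℤ, r = r' + n := by
  obtain ⟨p, rfl, hp⟩ := hr
  rw [surfaceCrossing_proj hs0 hs1] at hr'
  exact sub_mem_of_mem_crossing hp hr'

/-- Heights that are not obtained by a return all come from the first stay in `R⁺`. There need be no
first time, so two such heights are compared directly: the later one must already occur at the time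
of the earlier one, hence they agree modulo `1`. -/
theorem LocallyAffine.crossingSet_subset {s : ℝ} (hs0 : 0 < s) (hs1 : s < 1) {m : ℝ} {J : Set ℝ}
    (hJ : J.OrdConnected) {τ : ℝ → HomSurface s} (h : LocallyAffine s (0 < ·) (1, m) J τ) :
    ∃ a, crossingSet s m J τ ⊆ intTranslates a ∪ advance s m (crossingSet s m J τ) := by
  by_cases hall : crossingSet s m J τ ⊆ advance s m (crossingSet s m J τ)
  · exact ⟨0, hall.trans subset_union_right⟩
  obtain ⟨a, ha, ha'⟩ := not_subset.1 hall
  refine ⟨a, fun r hr => ?_⟩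
  by_cases hr' : r ∈ advance s m (crossingSet s m J τ)
  · exact Or.inr hr'
  left
  obtain ⟨t, ht, hat⟩ := mem_iUnion₂.1 ha
  obtain ⟨u, hu, hru⟩ := mem_iUnion₂.1 hr
  rcases le_total t u with htu | hut
  · have := (h.crossing_subset hs0 hs1 hJ ht hu htu ⟨a, hat⟩ hru).resolve_right hr'
    exact sub_mem_of_mem_surfaceCrossing hs0 hs1 this hat
  · have := (h.crossing_subset hs0 hs1 hJ hu ht hut ⟨r, hru⟩ hat).resolve_right ha'
    exact sub_mem_of_mem_surfaceCrossing hs0 hs1 hru this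

theorem add_intCast_mem_crossing {s m : ℝ} {p : ℝ × ℝ} {r : ℝ} (hr : r ∈ crossing s m p)
    (n : ℤ) : r + n ∈ crossing s m p := by
  rcases hr with ⟨h0, h1, k, rfl⟩ | ⟨h0, h1, h2, k, rfl⟩
  · exact Or.inl ⟨h0, h1, k + n, by push_cast; ring⟩
  · exact Or.inr ⟨h0, h1, h2, k + n, by push_cast; ring⟩

theorem add_intCast_mem_crossingSet {s m : ℝ} {J : Set ℝ} {τ : ℝ → HomSurface s} {r : ℝ}
    (hr : r ∈ crossingSet s m J τ) (n : ℤ) : r + n ∈ crossingSet s m J τ := by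
  obtain ⟨t, ht, p, hp, hrp⟩ := mem_iUnion₂.1 hr
  exact mem_iUnion₂.2 ⟨t, ht, p, hp, add_intCast_mem_crossing hrp n⟩

/-! ### Invariant sets of the first return are nowhere dense -/

open MeasureTheory

theorem isClosed_add_range_intCast {S : Set ℝ} (hS : IsCompact S) :
    IsClosed {r : ℝ | ∃ x ∈ S, ∃ n : ℤ, r = x + n} := by
  have h : IsClosed (Set.range ((↑) : ℤ → ℝ)) := Int.isClosedEmbedding_coe_real.isClosed_range
  have := h.add_right_of_isCompact hS
  convert this using 1
  ext r
  simp only [mem_ofPred_eq, Set.mem_add, mem_range, exists_exists_eq_and]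
  constructor
  · rintro ⟨x, hx, n, rfl⟩
    exact ⟨n, x, hx, add_comm _ _⟩
  · rintro ⟨n, x, hx, rfl⟩
    exact ⟨x, hx, n, add_comm _ _⟩

/-- Modulo a null set, one period of the closure `K` is contained in `S`, the image of one period of
`K` under a map of factor `s`. A finite measure that is at most `s < 1` times itself vanishes, and a
closed periodic null set contains no interval. -/
theorem interior_closure_eq_empty_of_subset_advance {s m a : ℝ} (hs0 : 0 < s) (hs1 : s < 1)
    {H : Set ℝ} (hper : ∀ r ∈ H, ∀ n : ℤ, r + n ∈ H)
    (hH : H ⊆ intTranslates a ∪ advance s m H) : interior (closure H) = ∅ := by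
  set K := closure H with hK
  have hperK : ∀ r ∈ K, ∀ n : ℤ, r + n ∈ K := fun r hr n =>
    map_mem_closure (f := fun x : ℝ => x + n) (by fun_prop) hr fun x hx => hper x hx n
  let S : Set ℝ := (fun h => s * (h + m * s)) '' (K ∩ Icc (-(m * s)) (1 - m * s))
  have hS : IsCompact S :=
    ((isCompact_Icc.inter_left isClosed_closure).image (by fun_prop))
  have hKsub : K ⊆ intTranslates a ∪ {r : ℝ | ∃ x ∈ S, ∃ n : ℤ, r = x + n} := by
    refine closure_minimal ?_ (IsClosed.union ?_ (isClosed_add_range_intCast hS))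
    · refine hH.trans (union_subset_union_right _ ?_)
      rintro r ⟨h, hh, h1, h2, n, rfl⟩
      exact ⟨_, ⟨h, ⟨subset_closure hh, by linarith, by linarith⟩, rfl⟩, n, rfl⟩
    · simpa [intTranslates] using isClosed_add_range_intCast (isCompact_singleton (x := a))
  -- All half-open unit intervals are fundamental domains of the translations by integers, under
  -- which `K` is invariant.
  have hmeas : ∀ t : ℝ, volume (K ∩ Ioc t (t + 1)) = volume (K ∩ Ioc 0 (0 + 1)) := by
    intro t
    refine (isAddFundamentalDomain_Ioc one_pos t volume).measure_set_eq
      (isAddFundamentalDomain_Ioc one_pos 0 volume) isClosed_closure.measurableSet ?_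
    rintro ⟨g, hg⟩
    obtain ⟨n, rfl⟩ := AddSubgroup.mem_zmultiples_iff.1 hg
    ext x
    simp only [mem_preimage, AddSubgroup.mk_vadd, vadd_eq_add, zsmul_eq_mul, mul_one]
    constructor
    · intro hx
      simpa using hperK _ hx (-n)
    · intro hx
      rw [add_comm]
      exact hperK _ hx n
  have hvolS : volume S ≤ ENNReal.ofReal s * volume (K ∩ Ioc 0 (0 + 1)) := by
    have e1 : S = (fun x => s * x) '' ((fun x => x + m * s) ''
        (K ∩ Icc (-(m * s)) (1 - m * s))) := by
      rw [image_image]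
    rw [e1, show (fun x => s * x) = fun x : ℝ => s • x from rfl, image_smul,
      Measure.addHaar_smul]
    simp only [Module.finrank_self, pow_one, abs_of_pos hs0, image_add_right,
      measure_preimage_add_right]
    refine mul_le_mul_right ?_ _
    rw [← hmeas (-(m * s))]
    have e2 : K ∩ Icc (-(m * s)) (1 - m * s) ⊆
        (K ∩ Ioc (-(m * s)) (-(m * s) + 1)) ∪ {-(m * s)} := by
      rintro x ⟨hx, h1, h2⟩
      rcases h1.eq_or_lt with h | h
      · exact Or.inr h.symm
      · exact Or.inl ⟨hx, h, by linarith⟩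
    refine (measure_mono e2).trans ((measure_union_le _ _).trans ?_)
    simp
  have hcount : ∀ b, volume (intTranslates b) = 0 := fun b => by
    have : intTranslates b = Set.range fun n : ℤ => b + n := by
      ext r
      simp [intTranslates, eq_comm]
    rw [this]
    exact (countable_range _).measure_zero _
  have hle : volume (K ∩ Ioc 0 (0 + 1)) ≤ volume S := by
    have : K ∩ Ioc 0 (0 + 1) ⊆ (intTranslates a ∪ intTranslates 0) ∪ S := by
      rintro r ⟨hr, h1, h2⟩
      rcases hKsub hr with h | ⟨_, ⟨x, ⟨hx, h3, h4⟩, rfl⟩, n, rfl⟩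
      · exact Or.inl (Or.inl h)
      · have l1 : 0 ≤ s * (x + m * s) := mul_nonneg hs0.le (by linarith)
        have l2 : s * (x + m * s) ≤ s * 1 := by gcongr; linarith
        simp only at h1 h2
        -- As `S ⊆ [0, s]` and `0 < r ≤ 1`, only `n = 0` and `n = 1` are possible; the latter forces
        -- `r = 1`, which is covered by the null set `intTranslates 0`.
        have n1 : (-1 : ℝ) < n := by linarith
        have n2 : (n : ℝ) ≤ 1 := by linarith
        have n1' : (-1 : ℤ) < n := by exact_mod_cast n1
        have n2' : n ≤ 1 := by exact_mod_cast n2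
        obtain rfl | rfl : n = 0 ∨ n = 1 := by omega
        · right
          simp only [Int.cast_zero, add_zero]
          exact ⟨x, ⟨hx, h3, h4⟩, rfl⟩
        · left; right
          push_cast at h2
          exact ⟨1, by push_cast; linarith⟩
    refine (measure_mono this).trans ((measure_union_le _ _).trans ?_)
    rw [measure_union_null (hcount a) (hcount 0), zero_add]
  have hzero : volume (K ∩ Ioc 0 (0 + 1)) = 0 := by
    by_contra hne
    have hfin : volume (K ∩ Ioc (0 : ℝ) (0 + 1)) ≠ ⊤ :=
      ((measure_mono inter_subset_right).trans_lt (by simp)).ne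
    have hlt : ENNReal.ofReal s * volume (K ∩ Ioc 0 (0 + 1)) <
        1 * volume (K ∩ Ioc (0 : ℝ) (0 + 1)) :=
      ENNReal.mul_lt_mul_left hne hfin (by simpa using hs1)
    rw [one_mul] at hlt
    exact absurd (hle.trans hvolS) hlt.not_ge
  by_contra hint
  obtain ⟨x, hx⟩ := nonempty_iff_ne_empty.2 hint
  have hopen : IsOpen (interior K ∩ Ioo (x - 1 / 2) (x + 1 / 2)) :=
    isOpen_interior.inter isOpen_Ioo
  have hpos := hopen.measure_pos volume ⟨x, hx, by linarith, by linarith⟩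
  refine hpos.ne' (measure_mono_null ?_ ((hmeas (x - 1 / 2)).trans hzero))
  exact fun y hy => ⟨interior_subset hy.1, hy.2.1, by linarith [hy.2.2]⟩

/-! ### Open sets that are avoided by a trajectory -/

/-- On `J`, the curve `τ` avoids the image in the surface of the set `V` in the plane. -/
def Avoids (s : ℝ) (J : Set ℝ) (τ : ℝ → HomSurface s) (V : Set (ℝ × ℝ)) : Prop :=
  ∀ t ∈ J, ∀ p : octagon s, (p : ℝ × ℝ) ∈ V → τ t ≠ HomSurface.proj s p

/-- The points of `V` whose line of slope `m` has a height outside the closed set `K` form an open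
set that the curve avoids. -/
theorem LocallyAffine.exists_avoids_of_right {s : ℝ} (hs0 : 0 < s) (hs1 : s < 1) {m : ℝ}
    {J : Set ℝ} (hJ : J.OrdConnected) {τ : ℝ → HomSurface s}
    (h : LocallyAffine s (0 < ·) (1, m) J τ) {V : Set (ℝ × ℝ)} (hV : IsOpen V)
    (hVne : V.Nonempty) (hVsub : V ⊆ Ioo 0 s ×ˢ Ioo 0 1) :
    ∃ W ⊆ V, IsOpen W ∧ W.Nonempty ∧ Avoids s J τ W := by
  obtain ⟨a, ha⟩ := h.crossingSet_subset hs0 hs1 hJ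
  set K := closure (crossingSet s m J τ) with hK
  have hint : interior K = ∅ := interior_closure_eq_empty_of_subset_advance hs0 hs1
    (fun r hr n => add_intCast_mem_crossingSet hr n) ha
  have hcont : Continuous fun p : ℝ × ℝ => p.2 - m * p.1 := by fun_prop
  refine ⟨V ∩ (fun p : ℝ × ℝ => p.2 - m * p.1) ⁻¹' Kᶜ, inter_subset_left,
    hV.inter (isClosed_closure.isOpen_compl.preimage hcont), ?_, ?_⟩
  · obtain ⟨⟨x, y⟩, hxy⟩ := hVne
    by_contra hc
    -- On a vertical slice of `V` the heights fill an open set, which cannot lie in `K`.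
    have hO : IsOpen ((fun r => (x, r + m * x)) ⁻¹' V : Set ℝ) :=
      hV.preimage (by fun_prop)
    have : ((fun r => (x, r + m * x)) ⁻¹' V : Set ℝ) ⊆ K := by
      intro r hr
      by_contra hrK
      exact hc ⟨(x, r + m * x), hr, by simpa using hrK⟩
    have hmem := interior_maximal this hO (show y - m * x ∈ _ by simpa using hxy)
    rw [hint] at hmem
    exact hmem
  · rintro t ht p ⟨hpV, hpK⟩ heq
    refine hpK (subset_closure (mem_iUnion₂.2 ⟨t, ht, ?_⟩))
    obtain ⟨⟨h1, h2⟩, -⟩ := hVsub hpV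
    rw [heq, surfaceCrossing_proj hs0 hs1, crossing_of_pos_of_lt h1 h2]
    exact mem_intTranslates_self _

/-- The horizontal coordinate is locally constant in time, hence a constant `ξ`, and removing the
line `x = ξ` from `V` leaves a nonempty open set. -/
theorem LocallyAffine.exists_avoids_of_vertical {s : ℝ} (hs0 : 0 < s) (hs1 : s < 1) {b : ℝ}
    {J : Set ℝ} (hJ : IsPreconnected J) {τ : ℝ → HomSurface s}
    (h : LocallyAffine s (· ≠ 0) (0, b) J τ) {V : Set (ℝ × ℝ)} (hV : IsOpen V)
    (hVne : V.Nonempty) (hVsub : V ⊆ Ioo 0 s ×ˢ Ioo 0 1) :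
    ∃ W ⊆ V, IsOpen W ∧ W.Nonempty ∧ Avoids s J τ W := by
  have hloc : ∀ t ∈ J, ∃ a, ∀ᶠ u in 𝓝 t, HasHorizontal s (τ u) a := by
    intro t ht
    obtain ⟨k, q, c, -, hu⟩ := h t ht
    refine ⟨chartHorizontal s k q.1, ?_⟩
    filter_upwards [hu] with u hu
    simpa using hu.hasHorizontal hs0 hs1
  choose! g hloc using hloc
  have hconst : ∃ ξ, ∀ t ∈ J, HasHorizontal s (τ t) ξ := by
    rcases J.eq_empty_or_nonempty with rfl | ⟨t₀, ht₀⟩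
    · exact ⟨0, by simp⟩
    have hg : ∀ t ∈ J, HasHorizontal s (τ t) (g t) := fun t ht => (hloc t ht).self_of_nhds
    have hcst : ∀ t ∈ J, g t = g t₀ := by
      intro t ht
      have : PreconnectedSpace J := Subtype.preconnectedSpace hJ
      have hlc : IsLocallyConstant fun t : J => g t := by
        refine (IsLocallyConstant.iff_eventually_eq _).2 fun t => ?_
        filter_upwards [continuous_subtype_val.continuousAt.eventually (hloc t t.2)] with u hu
        exact (hg u u.2).unique hs0 hs1 hu
      exact hlc.apply_eq_of_preconnectedSpace ⟨t, ht⟩ ⟨t₀, ht₀⟩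
    exact ⟨g t₀, fun t ht => hcst t ht ▸ hg t ht⟩
  obtain ⟨ξ, hξ⟩ := hconst
  have hcont : Continuous fun p : ℝ × ℝ => p.1 := by fun_prop
  refine ⟨V ∩ (fun p : ℝ × ℝ => p.1) ⁻¹' {ξ}ᶜ, inter_subset_left,
    hV.inter (isClosed_singleton.isOpen_compl.preimage hcont), ?_, ?_⟩
  · obtain ⟨⟨x, y⟩, hxy⟩ := hVne
    by_contra hc
    have hO : IsOpen ((fun r => (r, y)) ⁻¹' V : Set ℝ) := hV.preimage (by fun_prop)
    have : ((fun r => (r, y)) ⁻¹' V : Set ℝ) ⊆ {ξ} := by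
      intro r hr
      by_contra hrK
      exact hc ⟨(r, y), hr, hrK⟩
    have hmem := interior_maximal this hO (show x ∈ _ from hxy)
    rw [interior_singleton] at hmem
    exact hmem
  · rintro t ht p ⟨hpV, hpK⟩ heq
    obtain ⟨⟨h1, h2⟩, -⟩ := hVsub hpV
    have h3 : HasHorizontal s (τ t) (p : ℝ × ℝ).1 :=
      ⟨p, heq, (horizontal_of_mem_Ioo (by linarith) h2 h1.ne').symm⟩
    exact hpK (h3.unique hs0 hs1 (hξ t ht))

theorem LocallyAffine.exists_avoids {s : ℝ} (hs0 : 0 < s) (hs1 : s < 1) {v : ℝ × ℝ}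
    {J : Set ℝ} (hJ : J.OrdConnected) {τ : ℝ → HomSurface s}
    (h : LocallyAffine s (· ≠ 0) v J τ) {V : Set (ℝ × ℝ)} (hV : IsOpen V)
    (hVne : V.Nonempty) (hVsub : V ⊆ Ioo 0 s ×ˢ Ioo 0 1) :
    ∃ W ⊆ V, IsOpen W ∧ W.Nonempty ∧ Avoids s J τ W := by
  obtain ⟨v₁, v₂⟩ := v
  by_cases h1 : v₁ = 0
  · subst h1
    exact h.exists_avoids_of_vertical hs0 hs1 hJ.isPreconnected hV hVne hVsub
  · have hslope : (v₁, v₂) = v₁ • ((1 : ℝ), v₂ / v₁) := by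
      ext
      · simp
      · simp only [Prod.smul_mk, smul_eq_mul]
        field_simp
    rw [hslope] at h
    rcases (h.smul h1).pos_or_neg hs0 hs1 hJ.isPreconnected with h | h
    · exact h.exists_avoids_of_right hs0 hs1 hJ hV hVne hVsub
    · have hJ' : (-J).OrdConnected :=
        ⟨fun x hx y hy z hz => hJ.out hy hx ⟨neg_le_neg hz.2, neg_le_neg hz.1⟩⟩
      obtain ⟨W, hWV, hW, hWne, hav⟩ :=
        h.comp_neg.exists_avoids_of_right hs0 hs1 hJ' hV hVne hVsub
      refine ⟨W, hWV, hW, hWne, fun t ht p hp => ?_⟩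
      simpa using hav (-t) (by simpa using ht) p hp

/-! ### The rotation that exchanges the two rectangles -/

/-- The rotation by `π` about the centre of the polygon. -/
def halfTurn (s : ℝ) (p : ℝ × ℝ) : ℝ × ℝ := (-p.1, 1 + s - p.2)

theorem halfTurn_halfTurn (s : ℝ) (p : ℝ × ℝ) : halfTurn s (halfTurn s p) = p := by
  simp [halfTurn]

theorem continuous_halfTurn (s : ℝ) : Continuous (halfTurn s) := by
  unfold halfTurn
  fun_prop

theorem halfTurn_mem_octagon {s : ℝ} {p : ℝ × ℝ} (hp : p ∈ octagon s) :
    halfTurn s p ∈ octagon s := by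
  rcases hp with ⟨⟨h1, h2⟩, h3, h4⟩ | ⟨⟨h1, h2⟩, h3, h4⟩
  · refine Or.inr ⟨⟨?_, ?_⟩, ?_, ?_⟩ <;> simp only [halfTurn] <;> linarith
  · refine Or.inl ⟨⟨?_, ?_⟩, ?_, ?_⟩ <;> simp only [halfTurn] <;> linarith

theorem halfTurn_mem_interior_octagon {s : ℝ} {p : ℝ × ℝ} (hp : p ∈ interior (octagon s)) :
    halfTurn s p ∈ interior (octagon s) := by
  have h : halfTurn s ⁻¹' interior (octagon s) ⊆ octagon s := fun q hq => by
    rw [← halfTurn_halfTurn s q]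
    exact halfTurn_mem_octagon (interior_subset hq)
  refine mem_interior.2 ⟨halfTurn s ⁻¹' interior (octagon s), h,
    isOpen_interior.preimage (continuous_halfTurn s), ?_⟩
  simpa [halfTurn_halfTurn] using hp

theorem proj_halfTurn_eq_of_edgeGlue {s : ℝ} {p q p' q' : octagon s}
    (hp : (p' : ℝ × ℝ) = halfTurn s p) (hq : (q' : ℝ × ℝ) = halfTurn s q)
    (h : EdgeGlue s p q) : HomSurface.proj s p' = HomSurface.proj s q' := by
  obtain ⟨p, hpo⟩ := p
  obtain ⟨q, hqo⟩ := q
  simp only at hp hq h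
  cases h with
  | edgeA y hy =>
    refine Quot.sound ?_
    have := EdgeGlue.edgeC (s := s) (1 + s - y) ⟨by linarith [hy.2], by linarith [hy.1]⟩
    rw [hp, hq]
    convert this using 1
    · rfl
    · ext
      · simp [halfTurn]
      · simp only [halfTurn]
        ring
  | edgeB x hx =>
    refine (Quot.sound ?_).symm
    have := EdgeGlue.edgeD (s := s) (-x) ⟨by linarith [hx.2], by linarith [hx.1]⟩
    rw [hp, hq]
    convert this using 1 <;> simp [halfTurn]
  | edgeC y hy =>
    refine Quot.sound ?_
    have := EdgeGlue.edgeA (s := s) (1 + s - y) ⟨by linarith [hy.2], by linarith [hy.1]⟩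
    rw [hp, hq]
    convert this using 1
    · simp [halfTurn]
    · ext
      · simp [halfTurn]
      · simp only [halfTurn]
        ring
  | edgeD x hx =>
    refine (Quot.sound ?_).symm
    have := EdgeGlue.edgeB (s := s) (-x) ⟨by linarith [hx.2], by linarith [hx.1]⟩
    rw [hp, hq]
    convert this using 1 <;> simp [halfTurn]

/-- The involution of the surface that is induced by the rotation of the polygon. -/
def surfaceTurn (s : ℝ) : HomSurface s → HomSurface s :=
  Quot.lift (fun p : octagon s => HomSurface.proj s ⟨halfTurn s p, halfTurn_mem_octagon p.2⟩)
    fun _ _ h => proj_halfTurn_eq_of_edgeGlue rfl rfl h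

theorem surfaceTurn_proj {s : ℝ} (p : octagon s) : surfaceTurn s (HomSurface.proj s p) =
    HomSurface.proj s ⟨halfTurn s p, halfTurn_mem_octagon p.2⟩ := rfl

/-- The rotated chart. -/
def turnChart : ChartName → ChartName
  | .inner => .inner
  | .A => .C
  | .B => .D
  | .C => .A
  | .D => .B

/-- The translation by which a rotated chart differs from the chart that replaces it. -/
def turnShift : ChartName → ℝ
  | .B => 1
  | .D => 1
  | _ => 0

/-- The rotation permutes the charts up to a translation and commutes with the folding maps, except
on the seams of `B` and `D`, where the two lifts to the polygon are distinct but glued. -/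
theorem HasCoord.surfaceTurn {s : ℝ} {k : ChartName} {q : ℝ × ℝ} {x : HomSurface s}
    (h : HasCoord s k q x) :
    HasCoord s (turnChart k) (halfTurn s q + (0, turnShift k)) (surfaceTurn s x) := by
  obtain ⟨hq, p, hp, rfl⟩ := h
  have same : chartFold s (turnChart k) (halfTurn s q + (0, turnShift k)) =
      halfTurn s (chartFold s k q) → ∃ p' : octagon s, (p' : ℝ × ℝ) =
        chartFold s (turnChart k) (halfTurn s q + (0, turnShift k)) ∧
        _root_.surfaceTurn s (HomSurface.proj s p) = HomSurface.proj s p' := fun h =>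
    ⟨⟨halfTurn s p, halfTurn_mem_octagon p.2⟩, by simp only [h, hp], rfl⟩
  cases k with
  | inner =>
    refine ⟨?_, same ?_⟩
    · have e : halfTurn s q + (0, turnShift .inner) = halfTurn s q := by
        ext <;> simp [turnShift]
      rw [e]
      exact halfTurn_mem_interior_octagon hq
    · simp [turnChart, turnShift, chartFold]
  | A =>
    obtain ⟨⟨h1, h2⟩, h3, h4⟩ := hq
    refine ⟨⟨⟨?_, ?_⟩, ?_, ?_⟩, same ?_⟩
    iterate 4 simp only [halfTurn, turnShift, Prod.fst_add, Prod.snd_add]; linarith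
    simp only [chartFold, turnChart, turnShift, halfTurn, Prod.mk_add_mk, add_zero,
      neg_le_neg_iff]
    split_ifs with h
    · rfl
    · ext <;> simp only <;> ring
  | B =>
    obtain ⟨⟨h1, h2⟩, h3, h4⟩ := hq
    refine ⟨⟨⟨?_, ?_⟩, ?_, ?_⟩, ?_⟩
    iterate 4 simp only [halfTurn, turnShift, Prod.fst_add, Prod.snd_add]; linarith
    rcases lt_trichotomy q.2 1 with h | h | h
    · refine same ?_
      have h' : ¬ 1 + s - q.2 + 1 ≤ 1 + s := by linarith
      simp [chartFold, turnChart, turnShift, halfTurn, h.le, h']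
    -- On the seam both charts select the upper edge, while the rotation takes an upper edge to a
    -- lower one; `edgeD` identifies the two points.
    · have e1 : chartFold s .B q = (q.1, 1) := by
        simp only [chartFold, h.le, if_true]
        ext <;> simp [h]
      have e2 : chartFold s (turnChart .B) (halfTurn s q + (0, turnShift .B)) =
          (-q.1, 1 + s) := by
        simp [chartFold, turnChart, turnShift, halfTurn, h, add_comm s]
      have e3 : halfTurn s p = (-q.1, s) := by
        rw [hp, e1]
        simp [halfTurn]
      refine ⟨⟨(-q.1, 1 + s), Or.inr ⟨⟨by simp only; linarith, by simp only; linarith⟩,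
        by simp only; linarith, le_rfl⟩⟩, e2.symm, ?_⟩
      rw [surfaceTurn_proj]
      refine Quot.sound ?_
      simp only [e3]
      exact EdgeGlue.edgeD _ ⟨by linarith, by linarith⟩
    · refine same ?_
      have h' : 1 + s - q.2 + 1 ≤ 1 + s := by linarith
      simp only [chartFold, turnChart, turnShift, halfTurn, Prod.mk_add_mk, h.not_ge, h',
        if_true, if_false]
      ext <;> simp only <;> ring
  | C =>
    obtain ⟨⟨h1, h2⟩, h3, h4⟩ := hq
    refine ⟨⟨⟨?_, ?_⟩, ?_, ?_⟩, same ?_⟩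
    iterate 4 simp only [halfTurn, turnShift, Prod.fst_add, Prod.snd_add]; linarith
    simp only [chartFold, turnChart, turnShift, halfTurn, Prod.mk_add_mk, add_zero,
      neg_le (a := q.1)]
    split_ifs with h
    · rfl
    · ext <;> simp only <;> ring
  | D =>
    obtain ⟨⟨h1, h2⟩, h3, h4⟩ := hq
    refine ⟨⟨⟨?_, ?_⟩, ?_, ?_⟩, ?_⟩
    iterate 4 simp only [halfTurn, turnShift, Prod.fst_add, Prod.snd_add]; linarith
    rcases lt_trichotomy q.2 (1 + s) with h | h | h
    · refine same ?_
      have h' : ¬ 1 + s - q.2 + 1 ≤ 1 := by linarith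
      simp [chartFold, turnChart, turnShift, halfTurn, h.le, h']
    · have e1 : chartFold s .D q = (q.1, 1 + s) := by
        simp only [chartFold, h.le, if_true]
        ext <;> simp [h]
      have e2 : chartFold s (turnChart .D) (halfTurn s q + (0, turnShift .D)) =
          (-q.1, 1) := by
        simp [chartFold, turnChart, turnShift, halfTurn, h]
      have e3 : halfTurn s p = (-q.1, 0) := by
        rw [hp, e1]
        simp [halfTurn]
      refine ⟨⟨(-q.1, 1), Or.inl ⟨⟨by simp only; linarith, by simp only; linarith⟩,
        by simp only; linarith, le_rfl⟩⟩, e2.symm, ?_⟩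
      rw [surfaceTurn_proj]
      refine Quot.sound ?_
      simp only [e3]
      exact EdgeGlue.edgeB _ ⟨by linarith, by linarith⟩
    · refine same ?_
      have h' : 1 + s - q.2 + 1 ≤ 1 := by linarith
      simp only [chartFold, turnChart, turnShift, halfTurn, Prod.mk_add_mk, h.not_ge, h',
        if_true, if_false]
      ext <;> simp only <;> ring

/-- The rotation has linear part `-1`, so the direction is kept and the speed changes sign. -/
theorem LocallyAffine.surfaceTurn {s : ℝ} {v : ℝ × ℝ} {J : Set ℝ} {τ : ℝ → HomSurface s}
    (h : LocallyAffine s (· ≠ 0) v J τ) :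
    LocallyAffine s (· ≠ 0) v J (fun t => surfaceTurn s (τ t)) := by
  intro t ht
  obtain ⟨k, q, c, hc, hu⟩ := h t ht
  refine ⟨turnChart k, halfTurn s q + (0, turnShift k), -c, neg_ne_zero.2 hc,
    hu.mono fun u hu => ?_⟩
  convert hu.surfaceTurn using 1
  simp only [halfTurn]
  ext <;> simp <;> ring

theorem LocallyAffine.exists_avoids_left {s : ℝ} (hs0 : 0 < s) (hs1 : s < 1) {v : ℝ × ℝ}
    {J : Set ℝ} (hJ : J.OrdConnected) {τ : ℝ → HomSurface s}
    (h : LocallyAffine s (· ≠ 0) v J τ) {V : Set (ℝ × ℝ)} (hV : IsOpen V)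
    (hVne : V.Nonempty) (hVsub : V ⊆ Ioo (-s) 0 ×ˢ Ioo s (1 + s)) :
    ∃ W ⊆ V, IsOpen W ∧ W.Nonempty ∧ Avoids s J τ W := by
  obtain ⟨w₀, hw₀⟩ := hVne
  have hsub : halfTurn s ⁻¹' V ⊆ Ioo 0 s ×ˢ Ioo 0 1 := by
    intro p hp
    obtain ⟨⟨h1, h2⟩, h3, h4⟩ := hVsub hp
    simp only [halfTurn] at h1 h2 h3 h4
    exact ⟨⟨by linarith, by linarith⟩, by linarith, by linarith⟩
  obtain ⟨W, hWV, hW, ⟨w, hw⟩, hav⟩ := h.surfaceTurn.exists_avoids hs0 hs1 hJ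
    (V := halfTurn s ⁻¹' V) (hV.preimage (continuous_halfTurn s))
    ⟨halfTurn s w₀, by simpa [halfTurn_halfTurn] using hw₀⟩ hsub
  refine ⟨halfTurn s ⁻¹' W, fun p hp => ?_, hW.preimage (continuous_halfTurn s),
    ⟨halfTurn s w, by simpa [halfTurn_halfTurn] using hw⟩, fun t ht p hp heq => ?_⟩
  · simpa [halfTurn_halfTurn] using hWV hp
  · exact hav t ht ⟨halfTurn s p, halfTurn_mem_octagon p.2⟩ hp
      (by simp only [heq, surfaceTurn_proj])

/-! ### Images of trajectories are nowhere dense -/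

theorem not_edgeGlue_of_mem_rectangles {s : ℝ} (hs0 : 0 < s) {p q : ℝ × ℝ}
    (h : EdgeGlue s p q) : p ∉ Ioo 0 s ×ˢ Ioo 0 1 ∪ Ioo (-s) 0 ×ˢ Ioo s (1 + s) ∧
      q ∉ Ioo 0 s ×ˢ Ioo 0 1 ∪ Ioo (-s) 0 ×ˢ Ioo s (1 + s) := by
  cases h with
  | edgeA y hy => simp [hs0.le]
  | edgeB x hx => simp [hx.1.not_gt]
  | edgeC y hy => simp [hs0.le]
  | edgeD x hx => simp [hx.2.not_gt]

/-- No identification involves the open rectangles, so their subsets are saturated; hence open ones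
have open images in the surface. -/
theorem mem_iff_of_proj_eq {s : ℝ} (hs0 : 0 < s) {W : Set (ℝ × ℝ)}
    (hW : W ⊆ Ioo 0 s ×ˢ Ioo 0 1 ∪ Ioo (-s) 0 ×ˢ Ioo s (1 + s)) {p q : octagon s}
    (h : HomSurface.proj s p = HomSurface.proj s q) :
    (p : ℝ × ℝ) ∈ W ↔ (q : ℝ × ℝ) ∈ W := by
  refine Eq.to_iff (congrArg (Quot.lift (fun p : octagon s => (p : ℝ × ℝ) ∈ W) ?_) h)
  intro a b hab
  obtain ⟨h1, h2⟩ := not_edgeGlue_of_mem_rectangles hs0 hab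
  exact propext ⟨fun h => absurd (hW h) h1, fun h => absurd (hW h) h2⟩

theorem isOpen_image_proj {s : ℝ} (hs0 : 0 < s) {W : Set (ℝ × ℝ)}
    (hWo : IsOpen W) (hW : W ⊆ Ioo 0 s ×ˢ Ioo 0 1 ∪ Ioo (-s) 0 ×ˢ Ioo s (1 + s)) :
    IsOpen (HomSurface.proj s '' {p : octagon s | (p : ℝ × ℝ) ∈ W}) := by
  have hq : IsQuotientMap (HomSurface.proj s) := isQuotientMap_quot_mk
  rw [← hq.isOpen_preimage]
  convert hWo.preimage (continuous_subtype_val (p := (· ∈ octagon s))) using 1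
  ext p
  constructor
  · rintro ⟨q, hq, hqp⟩
    exact (mem_iff_of_proj_eq hs0 hW hqp).1 hq
  · exact fun hp => ⟨p, hp, rfl⟩

theorem exists_mem_rectangles {s : ℝ} (hs0 : 0 < s) {p : ℝ × ℝ} (hp : p ∈ octagon s)
    {O : Set (ℝ × ℝ)} (hO : IsOpen O) (hpO : p ∈ O) :
    (O ∩ Ioo 0 s ×ˢ Ioo 0 1).Nonempty ∨ (O ∩ Ioo (-s) 0 ×ˢ Ioo s (1 + s)).Nonempty := by
  rcases hp with hp | hp
  · left
    have : p ∈ closure (Ioo 0 s ×ˢ Ioo (0 : ℝ) 1) := by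
      rwa [closure_prod_eq, closure_Ioo hs0.ne, closure_Ioo zero_ne_one]
    exact mem_closure_iff.1 this O hO hpO
  · right
    have : p ∈ closure (Ioo (-s) 0 ×ˢ Ioo s (1 + s)) := by
      rwa [closure_prod_eq, closure_Ioo (by linarith), closure_Ioo (by linarith)]
    exact mem_closure_iff.1 this O hO hpO

/-- A nonempty open set of the surface meets one of the open rectangles, and there it contains a
nonempty open set that the curve avoids. -/
theorem LocallyAffine.interior_closure_image {s : ℝ} (hs0 : 0 < s) (hs1 : s < 1) {v : ℝ × ℝ}
    {J : Set ℝ} (hJ : J.OrdConnected) {τ : ℝ → HomSurface s}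
    (h : LocallyAffine s (· ≠ 0) v J τ) : interior (closure (τ '' J)) = ∅ := by
  by_contra hne
  obtain ⟨x, hx⟩ := nonempty_iff_ne_empty.2 hne
  obtain ⟨p, rfl⟩ := Quot.exists_rep x
  have hcont : Continuous (HomSurface.proj s) := continuous_quot_mk
  obtain ⟨O, hO, hOU⟩ := isOpen_induced_iff.1 (isOpen_interior.preimage hcont)
  have hpO : (p : ℝ × ℝ) ∈ O := by
    have : p ∈ Subtype.val ⁻¹' O := by
      rw [hOU]
      exact hx
    exact this
  have hex : ∃ W ⊆ O ∩ (Ioo 0 s ×ˢ Ioo 0 1 ∪ Ioo (-s) 0 ×ˢ Ioo s (1 + s)),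
      IsOpen W ∧ W.Nonempty ∧ Avoids s J τ W := by
    rcases exists_mem_rectangles hs0 p.2 hO hpO with hne | hne
    · obtain ⟨W, hW, h'⟩ := h.exists_avoids hs0 hs1 hJ
        (hO.inter (isOpen_Ioo.prod isOpen_Ioo)) hne inter_subset_right
      exact ⟨W, hW.trans (inter_subset_inter_right _ subset_union_left), h'⟩
    · obtain ⟨W, hW, h'⟩ := h.exists_avoids_left hs0 hs1 hJ
        (hO.inter (isOpen_Ioo.prod isOpen_Ioo)) hne inter_subset_right
      exact ⟨W, hW.trans (inter_subset_inter_right _ subset_union_right), h'⟩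
  obtain ⟨W, hW, hWo, ⟨w, hw⟩, hav⟩ := hex
  have hwo : w ∈ octagon s := (hW hw).2.imp
    (fun h => ⟨Ioo_subset_Icc_self h.1, Ioo_subset_Icc_self h.2⟩)
    (fun h => ⟨Ioo_subset_Icc_self h.1, Ioo_subset_Icc_self h.2⟩)
  have hwcl : HomSurface.proj s ⟨w, hwo⟩ ∈ closure (τ '' J) := by
    have : (⟨w, hwo⟩ : octagon s) ∈ Subtype.val ⁻¹' O := (hW hw).1
    rw [hOU] at this
    exact interior_subset this
  obtain ⟨_, ⟨q, hq, rfl⟩, t, ht, htq⟩ := mem_closure_iff.1 hwcl _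
    (isOpen_image_proj hs0 hWo (hW.trans inter_subset_right)) ⟨⟨w, hwo⟩, hw, rfl⟩
  exact hav t ht q hq htq

theorem IsLinearTrajectory.interior_closure_image {s : ℝ} (hs0 : 0 < s) (hs1 : s < 1)
    {I : Set ℝ} {τ : ℝ → HomSurface s} (h : IsLinearTrajectory s I τ) :
    interior (closure (τ '' I)) = ∅ := by
  obtain ⟨v, -, hv⟩ := h.constant_slope
  have hJ : (interior I).OrdConnected := h.interval.interior
  -- Affinity is known only in the interior of `I`; by continuity, end points add nothing to the
  -- closure of the image.
  have hI : I ⊆ closure (interior I) :=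
    subset_closure.trans ((Set.OrdConnected.convex (𝕜 := ℝ) h.interval).closure_interior_eq_closure_of_nonempty_interior
      h.nondegenerate).ge
  have hsub : τ '' I ⊆ closure (τ '' interior I) := by
    rintro _ ⟨t, ht, rfl⟩
    exact ((h.continuousOn t ht).mono interior_subset).mem_closure_image (hI ht)
  have hsub' : closure (τ '' I) ⊆ closure (τ '' interior I) :=
    closure_minimal hsub isClosed_closure
  refine subset_eq_empty (interior_mono hsub') ?_
  exact LocallyAffine.interior_closure_image hs0 hs1 (v := v) hJ hv

/-- Near a boundary point, the chart pulls the open half-plane back to a nonempty open subset of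
`Y`. -/
theorem IsSubsurface.interior_nonempty {X : Type*} [TopologicalSpace X] {Z Y : Set X}
    (h : IsSubsurface Z Y) : (interior Y).Nonempty := by
  obtain ⟨⟨p, hp⟩, hch⟩ := h
  obtain ⟨e, hpe, hY | ⟨hp0, hY⟩⟩ := hch p hp
  · exact ⟨p, mem_interior.2 ⟨e.source, hY, e.open_source, hpe⟩⟩
  · have hopen : IsOpen (e.target ∩ {z : ℝ × ℝ | 0 < z.1}) :=
      e.open_target.inter (isOpen_lt continuous_const continuous_fst)
    have hne : (e.target ∩ {z : ℝ × ℝ | 0 < z.1}).Nonempty := by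
      have ht : e.target ∈ 𝓝 (e p) := e.open_target.mem_nhds (e.map_source hpe)
      have hc : Tendsto (fun r : ℝ => ((r, (e p).2) : ℝ × ℝ)) (𝓝[>] 0) (𝓝 (e p)) := by
        refine ((show Continuous fun r : ℝ => ((r, (e p).2) : ℝ × ℝ) by fun_prop).tendsto' 0 _
          ?_).mono_left nhdsWithin_le_nhds
        rw [← hp0]
      have hpos : ∀ᶠ r in 𝓝[>] (0 : ℝ), 0 < r := eventually_mem_nhdsWithin
      obtain ⟨r, hr, hr'⟩ := ((hc.eventually ht).and hpos).exists
      exact ⟨_, hr, hr'⟩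
    obtain ⟨z, hz, hz'⟩ := hne
    refine ⟨e.symm z, mem_interior.2 ⟨e.source ∩ e ⁻¹' {z : ℝ × ℝ | 0 < z.1}, ?_,
      e.isOpen_inter_preimage (isOpen_lt continuous_const continuous_fst), e.map_target hz, ?_⟩⟩
    · exact fun x hx => (hY x hx.1).2 (le_of_lt hx.2)
    · simpa [e.right_inv hz] using hz'

theorem corollary1 (s : ℝ) (hs0 : 0 < s) (hs1 : s < 1)
    (I : Set ℝ) (τ : ℝ → HomSurface s) (hτ : IsLinearTrajectory s I τ) :
    ¬ Dense (τ '' I) ∧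
      ∀ Y : Set (HomSurface s), IsSubsurface (singularSet s) Y → ¬ Y ⊆ closure (τ '' I) := by
  have hint := hτ.interior_closure_image hs0 hs1
  constructor
  · intro hd
    obtain ⟨t, -⟩ := hτ.nondegenerate
    rw [hd.closure_eq, interior_univ] at hint
    exact (hint ▸ mem_univ (τ t) : τ t ∈ (∅ : Set (HomSurface s)))
  · intro Y hY hsub
    obtain ⟨x, hx⟩ := hY.interior_nonempty
    have := interior_mono hsub hx
    rw [hint] at this
    exact this
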